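/- Let $M$ be a smooth $n$-dimensional manifold and let $(H,\mathbf W,\mathbf h)$ be a Kundt$^\infty$ triple on $M$: a smooth Riemannian metric $\mathbf h$, a smooth one-form $\mathbf W$ and a smooth function $H$ on $M$ (with associated Lorentzian metric $2\,du\,(dv+v^2H\,du+v\mathbf W)+\mathbf h$). Let $R_{ijkl}$ be the Riemann tensor of $\mathbf h$, with the sign for which a space of constant curvature $\kappa$ has $R_{ijkl}=\kappa(h_{ik}h_{jl}-h_{il}h_{jk})$, and write $W_{i;j}=\nabla_jW_i$ for the Levi-Civita connection $\nabla$ of $\mathbf h$. For a real constant $\sigma$ put $$\mathsf a_{ij}=W_{[i;j]}=\tfrac12(W_{i;j}-W_{j;i}),\qquad \mathsf s_{ij}=W_{(i;j)}-\tfrac12W_iW_j,\qquad \alpha_i=\sigma W_i-\tfrac12(\mathsf s_{ij}+\mathsf a_{ij})W^j,$$ $$\beta_{ijk}=W^lR_{lijk}-W_i\mathsf a_{jk}+\tfrac12\big((\mathsf s_{ij}+\mathsf a_{ij})W_k-(\mathsf s_{ik}+\mathsf a_{ik})W_j\big).$$ Suppose that the triple satisfies the CSI$_0$ and CSI$_1$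 conditions on an open set $U\subseteq M$, that is: $H=\frac\sigma2+\frac18\|\mathbf W\|^2$ on $U$, and $\mathsf a,\mathsf s,\alpha,\beta$ are left-invariant, meaning that there is a real vector space $\mathcal K$ of smooth Killing vector fields $\xi$ of $(U,\mathbf h)$ whose values span $T_pM$ at every $p\in U$ and which satisfy $\pounds_\xi\mathsf a=0$, $\pounds_\xi\mathsf s=0$, $\pounds_\xi\alpha=0$, $\pounds_\xi\beta=0$ on $U$. For $p\in U$ let $I^1|_p=\{(\pounds_\xi\mathbf W)_p : \xi\in\mathcal K\}\subseteq T_p^*M\cong T_pM$ and $m=\dim I^1|_p$. Let $e_1,\dots,e_n$ be any orthonormal basis of $T_pM$ adapted to these covectors, i.e. such that the covectors $\mathbf h(e_1,\cdot),\dots,\mathbf h(e_m,\cdot)$ span $I^1|_p$. Let $I,J,K,L$ range over $1,\dots,m$ and $\hat i,\hat j,\hat k,\hat l$ over $m+1,\dots,n$. Then, relative to this basis and up to the antisymmetries of $R$ in its first and in its last pair of indices, the only components of the Riemann tensor at $p$ that can be nonzero are $$R_{IJKL},\qquad R_{I\hat jK\hat l},\qquad R_{\hat i\hat j\hat k\hat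 l};$$ and $$R_{IJKL}=\sigma(\delta_{IK}\delta_{JL}-\delta_{IL}\delta_{JK}).$$ -/

import Mathlib

open scoped Manifold ContDiff

noncomputable section

namespace Kundt

/-- The model space of an `n`-dimensional manifold. -/
abbrev E (n : ℕ) : Type := EuclideanSpace ℝ (Fin n)

/-- A Kundt^∞ triple `(H, W, h)` on the `n`-dimensional smooth manifold `M`: a smooth Riemannian
metric `h`, a smooth one-form `W` and a smooth function `H`. -/
structure Triple (n : ℕ) (M : Type*) [TopologicalSpace M] [ChartedSpace (E n) M]
    [IsManifold 𝓘(ℝ, E n) ∞ M] where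
  /-- the function `H` -/
  H : M → ℝ
  /-- the one-form `W` -/
  W : ∀ p : M, TangentSpace 𝓘(ℝ, E n) p →L[ℝ] ℝ
  /-- the Riemannian metric `h` -/
  h : Bundle.ContMDiffRiemannianMetric 𝓘(ℝ, E n) ∞ (E n)
    (fun p : M => TangentSpace 𝓘(ℝ, E n) p)
  contMDiff_H : ContMDiff 𝓘(ℝ, E n) 𝓘(ℝ) ∞ H
  contMDiff_W : ContMDiff 𝓘(ℝ, E n) (𝓘(ℝ, E n).prod 𝓘(ℝ, E n →L[ℝ] ℝ)) ∞
    (fun p => Bundle.TotalSpace.mk' (E n →L[ℝ] ℝ)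
      (E := fun p : M => TangentSpace 𝓘(ℝ, E n) p →L[ℝ] Bundle.Trivial M ℝ p) p (W p))

/-! ### Classical tensor calculus in a coordinate domain

`g`, `w` and `ξ` are the components of a metric, a one-form and a vector field, as functions of the
coordinates `x`. -/

section Coordinates

variable {n : ℕ}

/-- The partial derivative `∂_k f` at `x`. -/
def pd (k : Fin n) (f : E n → ℝ) (x : E n) : ℝ :=
  fderiv ℝ f x (EuclideanSpace.single k 1)

/-- The components `g^{ij}` of the inverse metric. -/
def ginv (g : E n → Fin n → Fin n → ℝ) (x : E n) (i j : Fin n) : ℝ :=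
  (Matrix.of (g x))⁻¹ i j

/-- The Christoffel symbols `Γ^k_{ij}` of the Levi-Civita connection of `g`. -/
def Gam (g : E n → Fin n → Fin n → ℝ) (x : E n) (k i j : Fin n) : ℝ :=
  ∑ l, (1 / 2 : ℝ) * ginv g x k l *
    (pd i (fun y => g y j l) x + pd j (fun y => g y i l) x - pd l (fun y => g y i j) x)

/-- `R^a_{bcd}`, the `a`-th component of `R(∂_c, ∂_d) ∂_b`, where
`R(X, Y) = ∇_X ∇_Y - ∇_Y ∇_X - ∇_[X, Y]`. -/
def riemUp (g : E n → Fin n → Fin n → ℝ) (x : E n) (a b c d : Fin n) : ℝ :=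
  pd c (fun y => Gam g y a d b) x - pd d (fun y => Gam g y a c b) x
    + ∑ e, (Gam g x a c e * Gam g x e d b - Gam g x a d e * Gam g x e c b)

/-- The Riemann tensor `R_{abcd}`, with the sign for which a space of constant curvature `κ` has
`R_{abcd} = κ (g_{ac} g_{bd} - g_{ad} g_{bc})`. -/
def riem (g : E n → Fin n → Fin n → ℝ) (x : E n) (a b c d : Fin n) : ℝ :=
  ∑ e, g x a e * riemUp g x e b c d

/-- `w_{i;j} = ∂_j w_i - Γ^k_{ij} w_k`; the derivative index comes last. -/
def covD (g : E n → Fin n → Fin n → ℝ) (w : E n → Fin n → ℝ) (x : E n) (i j : Fin n) : ℝ :=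
  pd j (fun y => w y i) x - ∑ k, Gam g x k i j * w x k

/-- The contravariant components `w^i = g^{ij} w_j`. -/
def raise (g : E n → Fin n → Fin n → ℝ) (w : E n → Fin n → ℝ) (x : E n) (i : Fin n) : ℝ :=
  ∑ j, ginv g x i j * w x j

/-- `‖w‖² = w_i w^i`. -/
def normSq (g : E n → Fin n → Fin n → ℝ) (w : E n → Fin n → ℝ) (x : E n) : ℝ :=
  ∑ i, w x i * raise g w x i

/-- `a_{ij} = w_{[i;j]} = (w_{i;j} - w_{j;i}) / 2`. -/
def tensorA (g : E n → Fin n → Fin n → ℝ) (w : E n → Fin n → ℝ) (x : E n) (i j : Fin n) : ℝ :=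
  (covD g w x i j - covD g w x j i) / 2

/-- `s_{ij} = w_{(i;j)} - w_i w_j / 2`. -/
def tensorS (g : E n → Fin n → Fin n → ℝ) (w : E n → Fin n → ℝ) (x : E n) (i j : Fin n) : ℝ :=
  (covD g w x i j + covD g w x j i) / 2 - w x i * w x j / 2

/-- `α_i = σ w_i - (1/2) (s_{ij} + a_{ij}) w^j`. -/
def tensorAlpha (σ : ℝ) (g : E n → Fin n → Fin n → ℝ) (w : E n → Fin n → ℝ) (x : E n)
    (i : Fin n) : ℝ :=
  σ * w x i - (1 / 2 : ℝ) * ∑ j, (tensorS g w x i j + tensorA g w x i j) * raise g w x j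

/-- `β_{ijk} = w^l R_{lijk} - w_i a_{jk} + (s_{i[j} + a_{i[j}) w_{k]}`. -/
def tensorBeta (g : E n → Fin n → Fin n → ℝ) (w : E n → Fin n → ℝ) (x : E n)
    (i j k : Fin n) : ℝ :=
  ∑ l, raise g w x l * riem g x l i j k - w x i * tensorA g w x j k
    + ((tensorS g w x i j + tensorA g w x i j) * w x k
        - (tensorS g w x i k + tensorA g w x i k) * w x j) / 2

/-- The Lie derivative along `ξ` of a covariant tensor field of rank one. -/
def lie1 (ξ : E n → Fin n → ℝ) (T : E n → Fin n → ℝ) (x : E n) (i : Fin n) : ℝ :=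
  ∑ l, (ξ x l * pd l (fun y => T y i) x + T x l * pd i (fun y => ξ y l) x)

/-- The Lie derivative along `ξ` of a covariant tensor field of rank two. -/
def lie2 (ξ : E n → Fin n → ℝ) (T : E n → Fin n → Fin n → ℝ) (x : E n) (i j : Fin n) : ℝ :=
  ∑ l, (ξ x l * pd l (fun y => T y i j) x + T x l j * pd i (fun y => ξ y l) x
    + T x i l * pd j (fun y => ξ y l) x)

/-- The Lie derivative along `ξ` of a covariant tensor field of rank three. -/
def lie3 (ξ : E n → Fin n → ℝ) (T : E n → Fin n → Fin n → Fin n → ℝ) (x : E n)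
    (i j k : Fin n) : ℝ :=
  ∑ l, (ξ x l * pd l (fun y => T y i j k) x + T x l j k * pd i (fun y => ξ y l) x
    + T x i l k * pd j (fun y => ξ y l) x + T x i j l * pd k (fun y => ξ y l) x)

/-- The component `R(e_a, e_b, e_c, e_d)` of the Riemann tensor at `x` in the frame
`e_a = e_a^i ∂_i`. -/
def frameRiem (g : E n → Fin n → Fin n → ℝ) (x : E n) (e : Fin n → Fin n → ℝ)
    (a b c d : Fin n) : ℝ :=
  ∑ i, ∑ j, ∑ k, ∑ l, riem g x i j k l * e a i * e b j * e c k * e d l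

/-- The frame `e_a = e_a^i ∂_i` at `x` is orthonormal. -/
def IsOrthonormalFrame (g : E n → Fin n → Fin n → ℝ) (x : E n) (e : Fin n → Fin n → ℝ) : Prop :=
  ∀ a b, ∑ i, ∑ j, g x i j * e a i * e b j = if a = b then 1 else 0

end Coordinates

/-! ### Components of fields on a manifold in a chart -/

section Manifold

variable {n : ℕ} {M : Type*} [TopologicalSpace M] [ChartedSpace (E n) M]

/-- The coordinate vector `∂_i` of the chart `φ`, at the point with coordinates `x`. -/
def coordVec (φ : OpenPartialHomeomorph M (E n)) (x : E n) (i : Fin n) :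
    TangentSpace 𝓘(ℝ, E n) (φ.symm x) :=
  mfderiv 𝓘(ℝ, E n) 𝓘(ℝ, E n) φ.symm x (EuclideanSpace.single i 1 : E n)

/-- The components `ξ^i` of a vector field in the chart `φ`. -/
def vecComp (ξ : ∀ p : M, TangentSpace 𝓘(ℝ, E n) p) (φ : OpenPartialHomeomorph M (E n))
    (x : E n) (i : Fin n) : ℝ :=
  let v : E n := mfderiv 𝓘(ℝ, E n) 𝓘(ℝ, E n) φ (φ.symm x) (ξ (φ.symm x))
  v i

variable [IsManifold 𝓘(ℝ, E n) ∞ M]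

/-- The components `h_{ij}` of the metric in the chart `φ`. -/
def Triple.hComp (T : Triple n M) (φ : OpenPartialHomeomorph M (E n)) (x : E n)
    (i j : Fin n) : ℝ :=
  T.h.inner (φ.symm x) (coordVec φ x i) (coordVec φ x j)

/-- The components `W_i` of the one-form in the chart `φ`. -/
def Triple.WComp (T : Triple n M) (φ : OpenPartialHomeomorph M (E n)) (x : E n)
    (i : Fin n) : ℝ :=
  T.W (φ.symm x) (coordVec φ x i)

/-- `ξ` is a smooth vector field on `U` along which the Lie derivatives of the metric `h` (so `ξ`
is a Killing field) and of the tensors `a`, `s`, `α`, `β` vanish on `U`, in every smooth chart. -/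
structure Triple.IsSymmetry (T : Triple n M) (σ : ℝ) (U : Set M)
    (ξ : ∀ p : M, TangentSpace 𝓘(ℝ, E n) p) : Prop where
  smooth : ContMDiffOn 𝓘(ℝ, E n) 𝓘(ℝ, E n).tangent ∞
    (fun p => (⟨p, ξ p⟩ : TangentBundle 𝓘(ℝ, E n) M)) U
  killing : ∀ φ ∈ IsManifold.maximalAtlas 𝓘(ℝ, E n) ∞ M, ∀ x ∈ φ.target, φ.symm x ∈ U →
    ∀ i j, lie2 (vecComp ξ φ) (T.hComp φ) x i j = 0
  lie_a : ∀ φ ∈ IsManifold.maximalAtlas 𝓘(ℝ, E n) ∞ M, ∀ x ∈ φ.target, φ.symm x ∈ U →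
    ∀ i j, lie2 (vecComp ξ φ) (tensorA (T.hComp φ) (T.WComp φ)) x i j = 0
  lie_s : ∀ φ ∈ IsManifold.maximalAtlas 𝓘(ℝ, E n) ∞ M, ∀ x ∈ φ.target, φ.symm x ∈ U →
    ∀ i j, lie2 (vecComp ξ φ) (tensorS (T.hComp φ) (T.WComp φ)) x i j = 0
  lie_alpha : ∀ φ ∈ IsManifold.maximalAtlas 𝓘(ℝ, E n) ∞ M, ∀ x ∈ φ.target, φ.symm x ∈ U →
    ∀ i, lie1 (vecComp ξ φ) (tensorAlpha σ (T.hComp φ) (T.WComp φ)) x i = 0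
  lie_beta : ∀ φ ∈ IsManifold.maximalAtlas 𝓘(ℝ, E n) ∞ M, ∀ x ∈ φ.target, φ.symm x ∈ U →
    ∀ i j k, lie3 (vecComp ξ φ) (tensorBeta (T.hComp φ) (T.WComp φ)) x i j k = 0

/-- The CSI₀ and CSI₁ conditions on `U`, with constant `σ` and with respect to the linear space `K`
of vector fields: `H = σ/2 + ‖W‖²/8`, and `a`, `s`, `α`, `β` are left-invariant, that is, invariant
under the Killing fields in `K`, which span every tangent space. -/
structure Triple.IsCSI (T : Triple n M) (σ : ℝ) (U : Set M)
    (K : Submodule ℝ (∀ p : M, TangentSpace 𝓘(ℝ, E n) p)) : Prop where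
  H_eq : ∀ φ ∈ IsManifold.maximalAtlas 𝓘(ℝ, E n) ∞ M, ∀ x ∈ φ.target, φ.symm x ∈ U →
    T.H (φ.symm x) = σ / 2 + normSq (T.hComp φ) (T.WComp φ) x / 8
  isSymmetry : ∀ ξ ∈ K, T.IsSymmetry σ U ξ
  transitive : ∀ p ∈ U, ∀ X : TangentSpace 𝓘(ℝ, E n) p, ∃ ξ ∈ K, ξ p = X

/-- The space `I¹` at the point with coordinates `x` in the chart `φ`: the covectors
`(£_ξ W)_i`, for `ξ` in `K`. -/
def Triple.I1 (T : Triple n M) (K : Submodule ℝ (∀ p : M, TangentSpace 𝓘(ℝ, E n) p))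
    (φ : OpenPartialHomeomorph M (E n)) (x : E n) : Submodule ℝ (Fin n → ℝ) :=
  Submodule.span ℝ {v | ∃ ξ ∈ K, v = lie1 (vecComp ξ φ) (T.WComp φ) x}

/-- The first `m` vectors of the frame `e`, turned into covectors `h_{ij} e_a^j`, span `I¹`. -/
def Triple.IsAdapted (T : Triple n M) (K : Submodule ℝ (∀ p : M, TangentSpace 𝓘(ℝ, E n) p))
    (φ : OpenPartialHomeomorph M (E n)) (x : E n) (m : ℕ) (e : Fin n → Fin n → ℝ) : Prop :=
  Submodule.span ℝ {v | ∃ a : Fin n, (a : ℕ) < m ∧ v = fun i => ∑ j, T.hComp φ x i j * e a j}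
    = T.I1 K φ x

end Manifold

end Kundt

end

/-!
The argument takes place in the coordinates of the chart, near the point `x`. Let `ξ` be one of the
given Killing fields and `η = £_ξ W`, and write `Q = s + a`, so that `W_{i;j} = Q_ij + W_i W_j / 2`.

A Killing field preserves the Levi-Civita connection (`along_lowGam`), so `£_ξ` commutes with the
covariant derivative (`lie2_covD`). As `Q` is invariant, this gives
`η_{i;j} = (η_i W_j + W_i η_j) / 2` near `x` (`covD_lie1`). Commuting second derivatives of `η`,
the Ricci identity becomes

  `η^l R_{lijk} = η_i a_jk + (Q_ik η_j - Q_ij η_k) / 2`    (`sum_lie1_mul_riemUp`),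

while invariance of `α` says `Q_ij η^j = 2 σ η_i` (`sum_mul_raise_lie1`). Both identities are
linear in `η`, so they hold on the span `I¹`, in particular for the covectors dual to the frame
vectors `e_1, …, e_m`. The rest is algebra (`frame_algebra`): contracting the first identity with
`η^i η^k` and using the antisymmetry of the Riemann tensor gives `a_ij η^j = 0`, then contracting
with `η^i` alone gives `a = 0` as soon as `η ≠ 0`. Thus `Q = s` is symmetric, each of
`e_1, …, e_m` is an eigenvector with eigenvalue `2 σ`, and the first identity now determines
`R_{Ijkl}`, up to the components `s_{ĵ l̂}`, which only enter `R_{I ĵ K l̂}`. The pair symmetry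
(`riem_pair_symm`) takes care of the components whose first two indices exceed `m`.
-/

namespace Kundt

open Finset

/-! ### Partial derivatives and Lie derivatives -/

section Coordinates

variable {n : ℕ} {O : Set (E n)} {x : E n}

lemma pd_congr (hO : IsOpen O) {f f' : E n → ℝ} (h : ∀ y ∈ O, f y = f' y) (hx : x ∈ O)
    (k : Fin n) : pd k f x = pd k f' x := by
  have : f =ᶠ[nhds x] f' := Filter.eventuallyEq_of_mem (hO.mem_nhds hx) h
  rw [pd, pd, this.fderiv_eq]

lemma contDiffOn_pd (hO : IsOpen O) {f : E n → ℝ} (hf : ContDiffOn ℝ ∞ f O) (k : Fin n) :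
    ContDiffOn ℝ ∞ (pd k f) O :=
  (hf.fderiv_of_isOpen hO (m := ∞) (by simp)).clm_apply contDiffOn_const

lemma differentiableAt_of_contDiffOn (hO : IsOpen O) {f : E n → ℝ} (hf : ContDiffOn ℝ ∞ f O)
    (hx : x ∈ O) : DifferentiableAt ℝ f x :=
  (hf.contDiffAt (hO.mem_nhds hx)).differentiableAt (by simp)

lemma pd_add {f f' : E n → ℝ} (hf : DifferentiableAt ℝ f x) (hf' : DifferentiableAt ℝ f' x)
    (k : Fin n) : pd k (fun y => f y + f' y) x = pd k f x + pd k f' x := by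
  simp [pd, fderiv_fun_add hf hf']

lemma pd_sub {f f' : E n → ℝ} (hf : DifferentiableAt ℝ f x) (hf' : DifferentiableAt ℝ f' x)
    (k : Fin n) : pd k (fun y => f y - f' y) x = pd k f x - pd k f' x := by
  simp [pd, fderiv_fun_sub hf hf']

lemma pd_mul {f f' : E n → ℝ} (hf : DifferentiableAt ℝ f x) (hf' : DifferentiableAt ℝ f' x)
    (k : Fin n) : pd k (fun y => f y * f' y) x = pd k f x * f' x + f x * pd k f' x := by
  simp [pd, fderiv_fun_mul hf hf']; ring

lemma pd_const_mul {f : E n → ℝ} (hf : DifferentiableAt ℝ f x) (c : ℝ)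
    (k : Fin n) : pd k (fun y => c * f y) x = c * pd k f x := by
  simp [pd, fderiv_const_mul hf]

lemma pd_sum {ι : Type*} {s : Finset ι} {f : ι → E n → ℝ} (hf : ∀ i, DifferentiableAt ℝ (f i) x)
    (k : Fin n) : pd k (fun y => ∑ i ∈ s, f i y) x = ∑ i ∈ s, pd k (f i) x := by
  simp [pd, fderiv_fun_sum fun i _ => hf i]

lemma pd_comm (hO : IsOpen O) {f : E n → ℝ} (hf : ContDiffOn ℝ ∞ f O) (hx : x ∈ O)
    (j k : Fin n) : pd j (pd k f) x = pd k (pd j f) x := by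
  have hc : ContDiffAt ℝ ∞ f x := hf.contDiffAt (hO.mem_nhds hx)
  have hs : IsSymmSndFDerivAt ℝ f x := hc.isSymmSndFDerivAt (by
    simpa using (mod_cast le_top : ((2 : ℕ∞) : WithTop ℕ∞) ≤ ∞))
  have hd : DifferentiableAt ℝ (fderiv ℝ f) x :=
    (hc.fderiv_right (m := ∞) (by simp)).differentiableAt (by simp)
  have h : ∀ a b : Fin n, pd a (pd b f) x =
      fderiv ℝ (fderiv ℝ f) x (EuclideanSpace.single a 1) (EuclideanSpace.single b 1) := by
    intro a b
    change fderiv ℝ (fun y => fderiv ℝ f y (EuclideanSpace.single b 1)) x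
      (EuclideanSpace.single a 1) = _
    rw [fderiv_clm_apply hd (differentiableAt_const _)]
    simp
  rw [h, h, hs]

/-- The derivative `ξ^l ∂_l f` of a function along a vector field. -/
noncomputable def along (ξ : E n → Fin n → ℝ) (f : E n → ℝ) (x : E n) : ℝ := ∑ l, ξ x l * pd l f x

section along

variable {ξ : E n → Fin n → ℝ}

lemma along_congr (hO : IsOpen O) {f f' : E n → ℝ} (h : ∀ y ∈ O, f y = f' y) (hx : x ∈ O) :
    along ξ f x = along ξ f' x := by
  simp only [along, pd_congr hO h hx]

lemma along_add {f f' : E n → ℝ} (hf : DifferentiableAt ℝ f x) (hf' : DifferentiableAt ℝ f' x) :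
    along ξ (fun y => f y + f' y) x = along ξ f x + along ξ f' x := by
  simp only [along, pd_add hf hf', mul_add, sum_add_distrib]

lemma along_sub {f f' : E n → ℝ} (hf : DifferentiableAt ℝ f x) (hf' : DifferentiableAt ℝ f' x) :
    along ξ (fun y => f y - f' y) x = along ξ f x - along ξ f' x := by
  simp only [along, pd_sub hf hf', mul_sub, sum_sub_distrib]

lemma along_mul {f f' : E n → ℝ} (hf : DifferentiableAt ℝ f x) (hf' : DifferentiableAt ℝ f' x) :
    along ξ (fun y => f y * f' y) x = along ξ f x * f' x + f x * along ξ f' x := by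
  simp only [along, pd_mul hf hf', mul_sum, sum_mul, ← sum_add_distrib]
  exact sum_congr rfl fun l _ => by ring

lemma along_const_mul {f : E n → ℝ} (hf : DifferentiableAt ℝ f x) (c : ℝ) :
    along ξ (fun y => c * f y) x = c * along ξ f x := by
  simp only [along, pd_const_mul hf, mul_sum]
  exact sum_congr rfl fun l _ => by ring

lemma along_sum {ι : Type*} {s : Finset ι} {f : ι → E n → ℝ}
    (hf : ∀ i, DifferentiableAt ℝ (f i) x) :
    along ξ (fun y => ∑ i ∈ s, f i y) x = ∑ i ∈ s, along ξ (f i) x := by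
  simp only [along, pd_sum hf, mul_sum]
  exact sum_comm

/-- The commutator `[ξ, ∂_k] = -(∂_k ξ^l) ∂_l`. -/
lemma along_pd (hO : IsOpen O) (hξ : ∀ i, ContDiffOn ℝ ∞ (fun y => ξ y i) O)
    {f : E n → ℝ} (hf : ContDiffOn ℝ ∞ f O) (hx : x ∈ O) (k : Fin n) :
    along ξ (pd k f) x =
      pd k (along ξ f) x - ∑ l, pd k (fun y => ξ y l) x * pd l f x := by
  have d := fun {f : E n → ℝ} (hf : ContDiffOn ℝ ∞ f O) => differentiableAt_of_contDiffOn hO hf hx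
  have h1 : pd k (along ξ f) x =
      ∑ l, (pd k (fun y => ξ y l) x * pd l f x + ξ x l * pd k (pd l f) x) := by
    change pd k (fun y => ∑ l, ξ y l * pd l f y) x = _
    rw [pd_sum fun l => d ((hξ l).mul (contDiffOn_pd hO hf l))]
    exact sum_congr rfl fun l _ => pd_mul (d (hξ l)) (d (contDiffOn_pd hO hf l)) k
  rw [h1, ← sum_sub_distrib]
  refine sum_congr rfl fun l _ => ?_
  rw [pd_comm hO hf hx l k]; ring

end along

lemma lie1_eq (ξ T : E n → Fin n → ℝ) (x : E n) (i : Fin n) :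
    lie1 ξ T x i = along ξ (fun y => T y i) x + ∑ l, T x l * pd i (fun y => ξ y l) x := by
  simp only [lie1, along, sum_add_distrib]

lemma lie2_eq (ξ : E n → Fin n → ℝ) (T : E n → Fin n → Fin n → ℝ) (x : E n) (i j : Fin n) :
    lie2 ξ T x i j = along ξ (fun y => T y i j) x + ∑ l, T x l j * pd i (fun y => ξ y l) x
      + ∑ l, T x i l * pd j (fun y => ξ y l) x := by
  simp only [lie2, along, sum_add_distrib]

lemma contDiffOn_lie1 (hO : IsOpen O) {ξ w : E n → Fin n → ℝ}
    (hξ : ∀ i, ContDiffOn ℝ ∞ (fun y => ξ y i) O) (hw : ∀ i, ContDiffOn ℝ ∞ (fun y => w y i) O)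
    (i : Fin n) : ContDiffOn ℝ ∞ (fun y => lie1 ξ w y i) O :=
  ContDiffOn.sum fun l _ => ((hξ l).mul (contDiffOn_pd hO (hw i) l)).add
    ((hw l).mul (contDiffOn_pd hO (hξ l) i))

/-! ### Metrics in a coordinate domain -/

lemma contDiffOn_det {A : E n → Matrix (Fin n) (Fin n) ℝ}
    (hA : ∀ i j, ContDiffOn ℝ ∞ (fun y => A y i j) O) :
    ContDiffOn ℝ ∞ (fun y => (A y).det) O := by
  simp only [Matrix.det_apply']
  exact ContDiffOn.sum fun τ _ => contDiffOn_const.mul (contDiffOn_prod fun i _ => hA _ _)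

/-- The components of a smooth metric on the open set `O` of a coordinate space. Only
nondegeneracy is required, not positivity. -/
structure IsMetricOn (g : E n → Fin n → Fin n → ℝ) (O : Set (E n)) : Prop where
  isOpen : IsOpen O
  smooth : ∀ i j, ContDiffOn ℝ ∞ (fun y => g y i j) O
  symm : ∀ y ∈ O, ∀ i j, g y i j = g y j i
  det_ne_zero : ∀ y ∈ O, (Matrix.of (g y)).det ≠ 0

/-- The Christoffel symbols of the first kind, `Γ_{m,ij} = g_{mk} Γ^k_{ij}`. -/
noncomputable def lowGam (g : E n → Fin n → Fin n → ℝ) (x : E n) (m i j : Fin n) : ℝ :=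
  (1 / 2 : ℝ) *
    (pd i (fun y => g y j m) x + pd j (fun y => g y i m) x - pd m (fun y => g y i j) x)

lemma Gam_eq (g : E n → Fin n → Fin n → ℝ) (x : E n) (k i j : Fin n) :
    Gam g x k i j = ∑ l, ginv g x k l * lowGam g x l i j :=
  sum_congr rfl fun l _ => by rw [lowGam]; ring

namespace IsMetricOn

variable {g : E n → Fin n → Fin n → ℝ} (hg : IsMetricOn g O)
include hg

lemma contDiffOn_ginv (i j : Fin n) : ContDiffOn ℝ ∞ (fun y => ginv g y i j) O := by
  have h : ∀ y, ginv g y i j =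
      ((Matrix.of (g y)).det)⁻¹ * ((Matrix.of (g y)).updateRow j (Pi.single i 1)).det := by
    intro y
    rw [ginv, Matrix.inv_def, Matrix.smul_apply, Matrix.adjugate_apply, Ring.inverse_eq_inv',
      smul_eq_mul]
  simp only [h]
  refine ((contDiffOn_det fun a b => hg.smooth a b).inv hg.det_ne_zero).mul
    (contDiffOn_det fun a b => ?_)
  simp only [Matrix.updateRow_apply]
  split_ifs
  · exact contDiffOn_const
  · exact hg.smooth a b

lemma sum_g_ginv (hx : x ∈ O) (i k : Fin n) :
    ∑ j, g x i j * ginv g x j k = if i = k then 1 else 0 := by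
  have := Matrix.mul_nonsing_inv (Matrix.of (g x)) (hg.det_ne_zero x hx).isUnit
  have := congrFun (congrFun this i) k
  rwa [Matrix.mul_apply, Matrix.one_apply] at this

lemma sum_ginv_g (hx : x ∈ O) (i k : Fin n) :
    ∑ j, ginv g x i j * g x j k = if i = k then 1 else 0 := by
  have := Matrix.nonsing_inv_mul (Matrix.of (g x)) (hg.det_ne_zero x hx).isUnit
  have := congrFun (congrFun this i) k
  rwa [Matrix.mul_apply, Matrix.one_apply] at this

lemma ginv_symm (hx : x ∈ O) (i j : Fin n) : ginv g x i j = ginv g x j i := by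
  have h : (Matrix.of (g x)).transpose = Matrix.of (g x) := by
    ext a b; exact hg.symm x hx b a
  have h' := Matrix.transpose_nonsing_inv (Matrix.of (g x))
  rw [h] at h'
  exact congrFun (congrFun h' j) i

/-- Lowering an index undoes raising it. -/
lemma sum_g_mul_sum_ginv (hx : x ∈ O) (v : Fin n → ℝ) (i : Fin n) :
    ∑ j, g x i j * ∑ k, ginv g x j k * v k = v i := by
  simp only [mul_sum, ← mul_assoc]
  rw [sum_comm]
  simp only [← sum_mul, hg.sum_g_ginv hx]
  simp

/-- Raising an index undoes lowering it. -/
lemma sum_ginv_mul_sum_g (hx : x ∈ O) (v : Fin n → ℝ) (i : Fin n) :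
    ∑ j, ginv g x i j * ∑ k, g x j k * v k = v i := by
  simp only [mul_sum, ← mul_assoc]
  rw [sum_comm]
  simp only [← sum_mul, hg.sum_ginv_g hx]
  simp

/-- Nondegeneracy: a vector is determined by its covariant components. -/
lemma eq_of_lower_eq (hx : x ∈ O) {u v : Fin n → ℝ}
    (h : ∀ i, ∑ j, g x i j * u j = ∑ j, g x i j * v j) (i : Fin n) : u i = v i := by
  rw [← hg.sum_ginv_mul_sum_g hx u, ← hg.sum_ginv_mul_sum_g hx v]
  simp only [h]

lemma lower_raise (hx : x ∈ O) (w : E n → Fin n → ℝ) (i : Fin n) :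
    ∑ j, g x i j * raise g w x j = w x i :=
  hg.sum_g_mul_sum_ginv hx (w x) i

lemma contDiffOn_raise {w : E n → Fin n → ℝ} (hw : ∀ i, ContDiffOn ℝ ∞ (fun y => w y i) O)
    (i : Fin n) : ContDiffOn ℝ ∞ (fun y => raise g w y i) O :=
  ContDiffOn.sum fun j _ => (hg.contDiffOn_ginv i j).mul (hw j)

lemma contDiffOn_lowGam (m i j : Fin n) : ContDiffOn ℝ ∞ (fun y => lowGam g y m i j) O :=
  contDiffOn_const.mul (((contDiffOn_pd hg.isOpen (hg.smooth j m) i).add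
    (contDiffOn_pd hg.isOpen (hg.smooth i m) j)).sub (contDiffOn_pd hg.isOpen (hg.smooth i j) m))

lemma contDiffOn_Gam (k i j : Fin n) : ContDiffOn ℝ ∞ (fun y => Gam g y k i j) O := by
  simp only [Gam_eq]
  exact ContDiffOn.sum fun l _ => (hg.contDiffOn_ginv k l).mul (hg.contDiffOn_lowGam l i j)

lemma pd_symm (hx : x ∈ O) (k i j : Fin n) :
    pd k (fun y => g y i j) x = pd k (fun y => g y j i) x :=
  pd_congr hg.isOpen (fun y hy => hg.symm y hy i j) hx k

lemma lowGam_symm (hx : x ∈ O) (m i j : Fin n) : lowGam g x m i j = lowGam g x m j i := by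
  rw [lowGam, lowGam, hg.pd_symm hx m i j]; ring

lemma Gam_symm (hx : x ∈ O) (m i j : Fin n) : Gam g x m i j = Gam g x m j i := by
  simp only [Gam_eq, hg.lowGam_symm hx _ i j]

lemma lower_Gam (hx : x ∈ O) (m i j : Fin n) :
    ∑ k, g x m k * Gam g x k i j = lowGam g x m i j := by
  simp only [Gam_eq]
  exact hg.sum_g_mul_sum_ginv hx (fun l => lowGam g x l i j) m

/-- The Levi-Civita connection is metric. -/
lemma pd_eq_lowGam (hx : x ∈ O) (c a b : Fin n) :
    pd c (fun y => g y a b) x = lowGam g x a c b + lowGam g x b c a := by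
  rw [lowGam, lowGam, hg.pd_symm hx b c a, hg.pd_symm hx c b a, hg.pd_symm hx a c b]; ring

/-! ### Symmetries of the Riemann tensor -/

/-- The Riemann tensor in terms of second derivatives of the metric and of Christoffel symbols. The
antisymmetry in the first pair of indices and the pair symmetry can be read off from it. -/
lemma riem_eq (hx : x ∈ O) (a b c d : Fin n) :
    riem g x a b c d =
      (1 / 2 : ℝ) * (pd c (pd b (fun y => g y a d)) x - pd c (pd a (fun y => g y b d)) x
        - pd d (pd b (fun y => g y a c)) x + pd d (pd a (fun y => g y b c)) x)
      - ∑ e, ∑ f, g x e f * (Gam g x e c a * Gam g x f d b - Gam g x e d a * Gam g x f c b) := by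
  have hO := hg.isOpen
  have d' := fun {f : E n → ℝ} (hf : ContDiffOn ℝ ∞ f O) => differentiableAt_of_contDiffOn hO hf hx
  have dpd := fun (k i j : Fin n) => d' (contDiffOn_pd hO (hg.smooth i j) k)
  -- Leibniz rule for `g_{ae} Γ^e_{db} = Γ_{a,db}`
  have key : ∀ c d, ∑ e, g x a e * pd c (fun y => Gam g y e d b) x =
      pd c (fun y => lowGam g y a d b) x
        - ∑ e, (lowGam g x a c e + lowGam g x e c a) * Gam g x e d b := by
    intro c d
    rw [pd_congr hO (fun y hy => (hg.lower_Gam hy a d b).symm) hx,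
      pd_sum fun e => d' ((hg.smooth a e).mul (hg.contDiffOn_Gam e d b)), ← sum_sub_distrib]
    refine sum_congr rfl fun e _ => ?_
    rw [pd_mul (d' (hg.smooth a e)) (d' (hg.contDiffOn_Gam e d b)), hg.pd_eq_lowGam hx]
    ring
  have pdl : ∀ c d, pd c (fun y => lowGam g y a d b) x = (1 / 2 : ℝ) *
      (pd c (pd d (fun y => g y b a)) x + pd c (pd b (fun y => g y d a)) x
        - pd c (pd a (fun y => g y d b)) x) := by
    intro c d
    change pd c (fun y => (1 / 2 : ℝ) * (pd d (fun y => g y b a) y + pd b (fun y => g y d a) y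
      - pd a (fun y => g y d b) y)) x = _
    rw [pd_const_mul (((dpd d b a).fun_add (dpd b d a)).fun_sub (dpd a d b)),
      pd_sub ((dpd d b a).fun_add (dpd b d a)) (dpd a d b), pd_add (dpd d b a) (dpd b d a)]
  have hs : ∀ p q i j, pd p (pd q (fun y => g y i j)) x = pd p (pd q (fun y => g y j i)) x :=
    fun p q i j => pd_congr hO (fun y hy => hg.pd_symm hy q i j) hx p
  have quad : ∀ c d, ∑ e, g x a e * ∑ f, Gam g x e c f * Gam g x f d b =
      ∑ e, lowGam g x a c e * Gam g x e d b := by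
    intro c d
    simp only [mul_sum, ← mul_assoc]
    rw [sum_comm]
    simp only [← sum_mul, hg.lower_Gam hx]
  have low : ∀ c d, ∑ e, lowGam g x e c a * Gam g x e d b =
      ∑ e, ∑ f, g x e f * (Gam g x e c a * Gam g x f d b) := by
    intro c d
    rw [sum_comm]
    refine sum_congr rfl fun f _ => ?_
    rw [← hg.lower_Gam hx, sum_mul]
    refine sum_congr rfl fun e _ => ?_
    rw [hg.symm x hx f e]; ring
  have expand : riem g x a b c d =
      ∑ e, g x a e * pd c (fun y => Gam g y e d b) x
        - ∑ e, g x a e * pd d (fun y => Gam g y e c b) x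
        + (∑ e, g x a e * ∑ f, Gam g x e c f * Gam g x f d b
          - ∑ e, g x a e * ∑ f, Gam g x e d f * Gam g x f c b) := by
    simp only [riem, riemUp, ← sum_sub_distrib, ← sum_add_distrib]
    exact sum_congr rfl fun e _ => by rw [sum_sub_distrib]; ring
  rw [expand, key, key, quad, quad, pdl, pdl]
  simp only [add_mul, sum_add_distrib, mul_sub, sum_sub_distrib, low]
  rw [pd_comm hO (hg.smooth b a) hx c d, hs c b d a, hs c a d b, hs d b c a, hs d a c b]
  ring

lemma sum_Gam_mul_Gam_comm (hx : x ∈ O) (p q r s : Fin n) :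
    ∑ e, ∑ f, g x e f * (Gam g x e p q * Gam g x f r s) =
      ∑ e, ∑ f, g x e f * (Gam g x e r s * Gam g x f p q) := by
  rw [sum_comm]
  exact sum_congr rfl fun e _ => sum_congr rfl fun f _ => by rw [hg.symm x hx f e]; ring

lemma riem_antisymm_left (hx : x ∈ O) (a b c d : Fin n) :
    riem g x a b c d = -riem g x b a c d := by
  rw [hg.riem_eq hx, hg.riem_eq hx]
  simp only [mul_sub, sum_sub_distrib]
  rw [hg.sum_Gam_mul_Gam_comm hx c a d b, hg.sum_Gam_mul_Gam_comm hx d a c b]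
  ring

lemma riem_pair_symm (hx : x ∈ O) (a b c d : Fin n) :
    riem g x a b c d = riem g x c d a b := by
  have hO := hg.isOpen
  have hs : ∀ p q i j, pd p (pd q (fun y => g y i j)) x = pd p (pd q (fun y => g y j i)) x :=
    fun p q i j => pd_congr hO (fun y hy => hg.pd_symm hy q i j) hx p
  rw [hg.riem_eq hx, hg.riem_eq hx]
  simp only [mul_sub, sum_sub_distrib]
  rw [hg.sum_Gam_mul_Gam_comm hx d a c b]
  simp only [fun k => hg.Gam_symm hx k c a, fun k => hg.Gam_symm hx k d b,
    fun k => hg.Gam_symm hx k c b, fun k => hg.Gam_symm hx k d a]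
  rw [pd_comm hO (hg.smooth a d) hx c b, pd_comm hO (hg.smooth b d) hx c a,
    pd_comm hO (hg.smooth a c) hx d b, pd_comm hO (hg.smooth b c) hx d a,
    hs b c a d, hs a c b d, hs b d a c, hs a d b c]
  ring

end IsMetricOn

/-! ### Lie derivatives along a Killing field -/

namespace IsMetricOn

variable {g : E n → Fin n → Fin n → ℝ} (hg : IsMetricOn g O)
  {ξ : E n → Fin n → ℝ} (hξ : ∀ i, ContDiffOn ℝ ∞ (fun y => ξ y i) O)
  (hK : ∀ y ∈ O, ∀ i j, lie2 ξ g y i j = 0)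
  {w : E n → Fin n → ℝ} (hw : ∀ i, ContDiffOn ℝ ∞ (fun y => w y i) O)

include hK in
/-- The Killing equation, solved for the derivative of the metric along `ξ`. -/
lemma along_g (hx : x ∈ O) (i j : Fin n) : along ξ (fun y => g y i j) x =
    -∑ l, (g x l j * pd i (fun y => ξ y l) x + g x i l * pd j (fun y => ξ y l) x) := by
  have := hK x hx i j
  rw [lie2_eq] at this
  rw [sum_add_distrib]; linarith

include hg hξ hK

lemma pd_along_g (hx : x ∈ O) (k i j : Fin n) :
    pd k (along ξ (fun y => g y i j)) x =
      -∑ l, (pd k (fun y => g y l j) x * pd i (fun y => ξ y l) x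
        + g x l j * pd k (pd i (fun y => ξ y l)) x
        + pd k (fun y => g y i l) x * pd j (fun y => ξ y l) x
        + g x i l * pd k (pd j (fun y => ξ y l)) x) := by
  have hO := hg.isOpen
  have d := fun {f : E n → ℝ} (hf : ContDiffOn ℝ ∞ f O) => differentiableAt_of_contDiffOn hO hf hx
  have dX := fun i l => contDiffOn_pd hO (hξ l) i
  rw [pd_congr hO (fun y hy => (along_g hK hy i j).trans (neg_one_mul _).symm) hx,
    pd_const_mul, neg_one_mul, pd_sum]
  · congr 1
    refine sum_congr rfl fun l _ => ?_
    rw [pd_add (d ((hg.smooth l j).mul (dX i l))) (d ((hg.smooth i l).mul (dX j l))),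
      pd_mul (d (hg.smooth l j)) (d (dX i l)), pd_mul (d (hg.smooth i l)) (d (dX j l))]
    ring
  · exact fun l => d (((hg.smooth l j).mul (dX i l)).add ((hg.smooth i l).mul (dX j l)))
  · exact d (ContDiffOn.sum fun l _ => ((hg.smooth l j).mul (dX i l)).add
      ((hg.smooth i l).mul (dX j l)))

/-- A Killing field preserves the Levi-Civita connection: up to the inhomogeneous term, the
Christoffel symbols transform like a tensor that it leaves invariant. -/
lemma along_lowGam (hx : x ∈ O) (m i j : Fin n) :
    along ξ (fun y => lowGam g y m i j) x =
      -∑ l, (g x m l * pd i (pd j (fun y => ξ y l)) x + pd i (fun y => ξ y l) x * lowGam g x m l j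
        + pd j (fun y => ξ y l) x * lowGam g x m i l
        + pd m (fun y => ξ y l) x * lowGam g x l i j) := by
  have hO := hg.isOpen
  have d := fun {f : E n → ℝ} (hf : ContDiffOn ℝ ∞ f O) => differentiableAt_of_contDiffOn hO hf hx
  have dpd := fun (k i j : Fin n) => d (contDiffOn_pd hO (hg.smooth i j) k)
  have h : along ξ (fun y => lowGam g y m i j) x = (1 / 2 : ℝ) *
      (along ξ (pd i (fun y => g y j m)) x + along ξ (pd j (fun y => g y i m)) x
        - along ξ (pd m (fun y => g y i j)) x) := by
    change along ξ (fun y => (1 / 2 : ℝ) * (pd i (fun y => g y j m) y + pd j (fun y => g y i m) y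
      - pd m (fun y => g y i j) y)) x = _
    rw [along_const_mul (((dpd i j m).fun_add (dpd j i m)).fun_sub (dpd m i j)),
      along_sub ((dpd i j m).fun_add (dpd j i m)) (dpd m i j), along_add (dpd i j m) (dpd j i m)]
  rw [h, along_pd hO hξ (hg.smooth _ _) hx, along_pd hO hξ (hg.smooth _ _) hx,
    along_pd hO hξ (hg.smooth _ _) hx, hg.pd_along_g hξ hK hx, hg.pd_along_g hξ hK hx,
    hg.pd_along_g hξ hK hx]
  simp only [← sum_neg_distrib, ← sum_sub_distrib, ← sum_add_distrib, mul_sum]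
  refine sum_congr rfl fun l _ => ?_
  rw [lowGam, lowGam, lowGam, pd_comm hO (hξ l) hx j i, pd_comm hO (hξ l) hx m i,
    pd_comm hO (hξ l) hx m j, hg.symm x hx l m, hg.symm x hx l j, hg.pd_symm hx i l m,
    hg.pd_symm hx j l m]
  ring

include hw

omit hξ in
/-- Raising an index commutes with the Lie derivative along a Killing field. -/
lemma along_raise (hx : x ∈ O) (k : Fin n) :
    along ξ (fun y => raise g w y k) x =
      raise g (lie1 ξ w) x k + ∑ l, raise g w x l * pd l (fun y => ξ y k) x := by
  have hO := hg.isOpen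
  have d := fun {f : E n → ℝ} (hf : ContDiffOn ℝ ∞ f O) => differentiableAt_of_contDiffOn hO hf hx
  refine hg.eq_of_lower_eq hx (u := fun k => along ξ (fun y => raise g w y k) x)
    (v := fun k => raise g (lie1 ξ w) x k + ∑ l, raise g w x l * pd l (fun y => ξ y k) x)
    (fun i => ?_) k
  -- Leibniz rule for `g_{ij} w^j = w_i`
  have h1 : along ξ (fun y => w y i) x = ∑ j, (along ξ (fun y => g y i j) x * raise g w x j
      + g x i j * along ξ (fun y => raise g w y j) x) := by
    rw [along_congr hO (fun y hy => (hg.lower_raise hy w i).symm) hx,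
      along_sum fun j => d ((hg.smooth i j).mul (hg.contDiffOn_raise hw j))]
    exact sum_congr rfl fun j _ => along_mul (d (hg.smooth i j)) (d (hg.contDiffOn_raise hw j))
  have h2 := lie1_eq ξ w x i
  have h3 := hg.lower_raise hx (lie1 ξ w) i
  have h4 : ∑ j, along ξ (fun y => g y i j) x * raise g w x j =
      -∑ l, w x l * pd i (fun y => ξ y l) x
        - ∑ j, g x i j * ∑ l, raise g w x l * pd l (fun y => ξ y j) x := by
    simp only [along_g hK hx, ← hg.lower_raise hx w, neg_mul, sum_neg_distrib, sum_mul,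
      add_mul, sum_add_distrib, mul_sum]
    rw [sub_eq_add_neg, ← neg_add, sum_comm]
    congr 2
    · exact sum_congr rfl fun a _ => sum_congr rfl fun b _ => by ring
    · rw [sum_comm]
      exact sum_congr rfl fun a _ => sum_congr rfl fun b _ => by ring
  rw [sum_add_distrib, h4] at h1
  simp only [mul_add, sum_add_distrib, h3]
  linarith

omit hξ hK hw in
/-- The covariant derivative in terms of Christoffel symbols of the first kind. These involve no
inverse metric, which makes their Lie derivative accessible. -/
lemma covD_eq (hx : x ∈ O) (w : E n → Fin n → ℝ) (i j : Fin n) :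
    covD g w x i j = pd j (fun y => w y i) x - ∑ m, lowGam g x m i j * raise g w x m := by
  rw [covD]
  congr 1
  simp only [Gam_eq, raise, sum_mul, mul_sum]
  rw [sum_comm]
  exact sum_congr rfl fun l _ => sum_congr rfl fun k _ => by rw [hg.ginv_symm hx l k]; ring

omit hξ hK in
lemma contDiffOn_covD (i j : Fin n) : ContDiffOn ℝ ∞ (fun y => covD g w y i j) O :=
  (contDiffOn_pd hg.isOpen (hw i) j).sub
    (ContDiffOn.sum fun k _ => (hg.contDiffOn_Gam k i j).mul (hw k))

/-- The Lie derivative along a Killing field commutes with the covariant derivative. -/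
lemma lie2_covD (hx : x ∈ O) (i j : Fin n) :
    lie2 ξ (covD g w) x i j = covD g (lie1 ξ w) x i j := by
  have hO := hg.isOpen
  have d := fun {f : E n → ℝ} (hf : ContDiffOn ℝ ∞ f O) => differentiableAt_of_contDiffOn hO hf hx
  have dX := fun i l => contDiffOn_pd hO (hξ l) i
  have hη := contDiffOn_lie1 hO hξ hw
  have h1 : along ξ (fun y => covD g w y i j) x = along ξ (pd j (fun y => w y i)) x
      - ∑ m, (along ξ (fun y => lowGam g y m i j) x * raise g w x m
        + lowGam g x m i j * along ξ (fun y => raise g w y m) x) := by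
    have hm := fun m => (hg.contDiffOn_lowGam m i j).mul (hg.contDiffOn_raise hw m)
    rw [along_congr hO (fun y hy => hg.covD_eq hy w i j) hx,
      along_sub (d (contDiffOn_pd hO (hw i) j)) (d (ContDiffOn.sum fun m _ => hm m)),
      along_sum fun m => d (hm m)]
    congr 1
    exact sum_congr rfl fun m _ =>
      along_mul (d (hg.contDiffOn_lowGam m i j)) (d (hg.contDiffOn_raise hw m))
  have h2 : pd j (along ξ (fun y => w y i)) x = pd j (fun y => lie1 ξ w y i) x
      - ∑ l, (pd j (fun y => w y l) x * pd i (fun y => ξ y l) x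
        + w x l * pd j (pd i (fun y => ξ y l)) x) := by
    have hl := fun l => (hw l).mul (dX i l)
    rw [pd_congr hO (f' := fun y => lie1 ξ w y i - ∑ l, w y l * pd i (fun y => ξ y l) y)
      (fun y _ => by rw [lie1_eq]; ring) hx,
      pd_sub (d (hη i)) (d (ContDiffOn.sum fun l _ => hl l)), pd_sum fun l => d (hl l)]
    congr 1
    exact sum_congr rfl fun l _ => pd_mul (d (hw l)) (d (dX i l)) j
  -- the terms with second derivatives of `ξ`
  have h3 : ∑ m, (∑ l, g x m l * pd i (pd j (fun y => ξ y l)) x) * raise g w x m =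
      ∑ l, w x l * pd j (pd i (fun y => ξ y l)) x := by
    simp only [sum_mul]
    rw [sum_comm]
    refine sum_congr rfl fun l _ => ?_
    rw [← hg.lower_raise hx w l, sum_mul, pd_comm hO (hξ l) hx j i]
    exact sum_congr rfl fun m _ => by rw [hg.symm x hx m l]; ring
  have h4 : ∑ m, (∑ l, pd m (fun y => ξ y l) x * lowGam g x l i j) * raise g w x m =
      ∑ m, lowGam g x m i j * ∑ l, raise g w x l * pd l (fun y => ξ y m) x := by
    simp only [sum_mul, mul_sum]
    rw [sum_comm]
    exact sum_congr rfl fun l _ => sum_congr rfl fun m _ => by ring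
  have h5 : ∑ l, covD g w x l j * pd i (fun y => ξ y l) x =
      ∑ l, pd j (fun y => w y l) x * pd i (fun y => ξ y l) x
        - ∑ m, (∑ l, pd i (fun y => ξ y l) x * lowGam g x m l j) * raise g w x m := by
    simp only [hg.covD_eq hx w, sub_mul, sum_sub_distrib, sum_mul]
    congr 1
    rw [sum_comm]
    exact sum_congr rfl fun m _ => sum_congr rfl fun l _ => by ring
  have h6 : ∑ l, covD g w x i l * pd j (fun y => ξ y l) x =
      ∑ l, pd j (fun y => ξ y l) x * pd l (fun y => w y i) x
        - ∑ m, (∑ l, pd j (fun y => ξ y l) x * lowGam g x m i l) * raise g w x m := by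
    simp only [hg.covD_eq hx w, sub_mul, sum_sub_distrib, sum_mul]
    congr 1
    · exact sum_congr rfl fun m _ => by ring
    · rw [sum_comm]
      exact sum_congr rfl fun m _ => sum_congr rfl fun l _ => by ring
  rw [lie2_eq, h1, h5, h6, along_pd hO hξ (hw i) hx, h2, hg.covD_eq hx]
  simp only [hg.along_lowGam hξ hK hx, hg.along_raise hK hw hx, sum_add_distrib, neg_mul,
    add_mul, mul_add, sum_neg_distrib, h3, h4]
  ring

end IsMetricOn

/-! ### The Ricci identity for `£_ξ W` -/

namespace IsMetricOn

variable {g : E n → Fin n → Fin n → ℝ} (hg : IsMetricOn g O)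
  {ξ : E n → Fin n → ℝ} (hξ : ∀ i, ContDiffOn ℝ ∞ (fun y => ξ y i) O)
  (hK : ∀ y ∈ O, ∀ i j, lie2 ξ g y i j = 0)
  {w : E n → Fin n → ℝ} (hw : ∀ i, ContDiffOn ℝ ∞ (fun y => w y i) O)
  (ha : ∀ y ∈ O, ∀ i j, lie2 ξ (tensorA g w) y i j = 0)
  (hs : ∀ y ∈ O, ∀ i j, lie2 ξ (tensorS g w) y i j = 0)

include hg hw

lemma contDiffOn_tensorA (i j : Fin n) : ContDiffOn ℝ ∞ (fun y => tensorA g w y i j) O :=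
  ((hg.contDiffOn_covD hw i j).sub (hg.contDiffOn_covD hw j i)).div_const 2

lemma contDiffOn_tensorS (i j : Fin n) : ContDiffOn ℝ ∞ (fun y => tensorS g w y i j) O :=
  (((hg.contDiffOn_covD hw i j).add (hg.contDiffOn_covD hw j i)).div_const 2).sub
    (((hw i).mul (hw j)).div_const 2)

include ha hs

lemma along_tensorS_add_tensorA (hx : x ∈ O) (i j : Fin n) :
    along ξ (fun y => tensorS g w y i j + tensorA g w y i j) x =
      -∑ l, (tensorS g w x l j + tensorA g w x l j) * pd i (fun y => ξ y l) x
        - ∑ l, (tensorS g w x i l + tensorA g w x i l) * pd j (fun y => ξ y l) x := by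
  have d := fun {f : E n → ℝ} (hf : ContDiffOn ℝ ∞ f O) =>
    differentiableAt_of_contDiffOn hg.isOpen hf hx
  have h1 := ha x hx i j
  have h2 := hs x hx i j
  rw [lie2_eq] at h1 h2
  rw [along_add (d (hg.contDiffOn_tensorS hw i j)) (d (hg.contDiffOn_tensorA hw i j))]
  simp only [add_mul, sum_add_distrib]
  linarith

include hξ hK

/-- Invariance of `a` and `s` turns into a first order equation for `η = £_ξ w`:
`η_{i;j} = (η_i w_j + w_i η_j) / 2`. -/
lemma covD_lie1 (hx : x ∈ O) (i j : Fin n) :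
    covD g (lie1 ξ w) x i j = (lie1 ξ w x i * w x j + w x i * lie1 ξ w x j) / 2 := by
  have hO := hg.isOpen
  have d := fun {f : E n → ℝ} (hf : ContDiffOn ℝ ∞ f O) => differentiableAt_of_contDiffOn hO hf hx
  have hdec : ∀ y i j, covD g w y i j =
      tensorS g w y i j + tensorA g w y i j + (1 / 2 : ℝ) * (w y i * w y j) := by
    intro y i j; rw [tensorS, tensorA]; ring
  rw [← hg.lie2_covD hξ hK hw hx, lie2_eq,
    along_congr hO (fun y _ => hdec y i j) hx,
    along_add (d ((hg.contDiffOn_tensorS hw i j).add (hg.contDiffOn_tensorA hw i j)))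
      (d (contDiffOn_const.mul ((hw i).mul (hw j)))),
    along_const_mul (d ((hw i).mul (hw j))), along_mul (d (hw i)) (d (hw j)),
    hg.along_tensorS_add_tensorA hw ha hs hx, lie1_eq, lie1_eq]
  have h1 : ∑ l, covD g w x l j * pd i (fun y => ξ y l) x =
      ∑ l, (tensorS g w x l j + tensorA g w x l j) * pd i (fun y => ξ y l) x
        + (1 / 2 : ℝ) * ((∑ l, w x l * pd i (fun y => ξ y l) x) * w x j) := by
    rw [sum_mul, mul_sum, ← sum_add_distrib]
    exact sum_congr rfl fun l _ => by rw [hdec]; ring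
  have h2 : ∑ l, covD g w x i l * pd j (fun y => ξ y l) x =
      ∑ l, (tensorS g w x i l + tensorA g w x i l) * pd j (fun y => ξ y l) x
        + (1 / 2 : ℝ) * (w x i * ∑ l, w x l * pd j (fun y => ξ y l) x) := by
    rw [mul_sum, mul_sum, ← sum_add_distrib]
    exact sum_congr rfl fun l _ => by rw [hdec]; ring
  rw [h1, h2]
  ring

/-- The integrability condition of the equation `covD_lie1` for `η = £_ξ w`. -/
lemma sum_lie1_mul_riemUp (hx : x ∈ O) (i j k : Fin n) :
    ∑ l, lie1 ξ w x l * riemUp g x l i j k = lie1 ξ w x i * tensorA g w x j k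
      + ((tensorS g w x i k + tensorA g w x i k) * lie1 ξ w x j
        - (tensorS g w x i j + tensorA g w x i j) * lie1 ξ w x k) / 2 := by
  have hO := hg.isOpen
  have d := fun {f : E n → ℝ} (hf : ContDiffOn ℝ ∞ f O) => differentiableAt_of_contDiffOn hO hf hx
  have hη := contDiffOn_lie1 hO hξ hw
  have hpd : ∀ y ∈ O, ∀ i j, pd j (fun y => lie1 ξ w y i) y =
      ∑ l, Gam g y l i j * lie1 ξ w y l
        + (1 / 2 : ℝ) * (lie1 ξ w y i * w y j + w y i * lie1 ξ w y j) := by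
    intro y hy i j
    have := hg.covD_lie1 hξ hK hw ha hs hy i j
    rw [covD] at this
    linarith
  have hpdw : ∀ i j, pd j (fun y => w y i) x = covD g w x i j + ∑ l, Gam g x l i j * w x l := by
    intro i j; rw [covD]; ring
  have hpd2 : ∀ j k, pd k (pd j (fun y => lie1 ξ w y i)) x =
      ∑ l, (pd k (fun y => Gam g y l i j) x * lie1 ξ w x l
          + Gam g x l i j * pd k (fun y => lie1 ξ w y l) x)
        + (1 / 2 : ℝ) * (pd k (fun y => lie1 ξ w y i) x * w x j
          + lie1 ξ w x i * pd k (fun y => w y j) x + (pd k (fun y => w y i) x * lie1 ξ w x j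
          + w x i * pd k (fun y => lie1 ξ w y j) x)) := by
    intro j k
    have hl := fun l => (hg.contDiffOn_Gam l i j).mul (hη l)
    have hr := ((hη i).mul (hw j)).add ((hw i).mul (hη j))
    rw [pd_congr hO (fun y hy => hpd y hy i j) hx,
      pd_add (d (ContDiffOn.sum fun l _ => hl l)) (d (contDiffOn_const.mul hr)),
      pd_sum fun l => d (hl l), pd_const_mul (d hr),
      pd_add (d ((hη i).mul (hw j))) (d ((hw i).mul (hη j))), pd_mul (d (hη i)) (d (hw j)),
      pd_mul (d (hw i)) (d (hη j))]
    congr 1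
    exact sum_congr rfl fun l _ => pd_mul (d (hg.contDiffOn_Gam l i j)) (d (hη l)) k
  have hcomm := pd_comm hO (hη i) hx k j
  have hquad : ∀ j k, ∑ l, Gam g x l i j * ∑ m, Gam g x m l k * lie1 ξ w x m =
      ∑ l, lie1 ξ w x l * ∑ e, Gam g x l k e * Gam g x e j i := by
    intro j k
    simp only [mul_sum]
    rw [sum_comm]
    refine sum_congr rfl fun l _ => sum_congr rfl fun e _ => ?_
    rw [hg.Gam_symm hx e i j, hg.Gam_symm hx l e k]; ring
  have hlin : ∀ (j : Fin n) (v : Fin n → ℝ) (c : ℝ), ∑ l, Gam g x l i j *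
      ((1 / 2 : ℝ) * (v l * c)) = (1 / 2 : ℝ) * ((∑ l, Gam g x l i j * v l) * c) := by
    intro j v c
    rw [sum_mul, mul_sum]
    exact sum_congr rfl fun l _ => by ring
  have hriem : ∑ l, lie1 ξ w x l * riemUp g x l i j k =
      ∑ l, pd j (fun y => Gam g y l i k) x * lie1 ξ w x l
        - ∑ l, pd k (fun y => Gam g y l i j) x * lie1 ξ w x l
        + (∑ l, lie1 ξ w x l * ∑ e, Gam g x l j e * Gam g x e k i
          - ∑ l, lie1 ξ w x l * ∑ e, Gam g x l k e * Gam g x e j i) := by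
    rw [← sum_sub_distrib, ← sum_sub_distrib, ← sum_add_distrib]
    refine sum_congr rfl fun l _ => ?_
    rw [riemUp, sum_sub_distrib, pd_congr hO (fun y hy => hg.Gam_symm hy l k i) hx,
      pd_congr hO (fun y hy => hg.Gam_symm hy l j i) hx]
    ring
  have hG : ∀ v : Fin n → ℝ, ∑ l, Gam g x l k j * v l = ∑ l, Gam g x l j k * v l :=
    fun v => sum_congr rfl fun l _ => by rw [hg.Gam_symm hx l k j]
  rw [hpd2, hpd2] at hcomm
  simp only [hpd x hx, hpdw, mul_add, sum_add_distrib, hlin, hquad, hG] at hcomm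
  rw [hriem]
  simp only [tensorS, tensorA]
  linear_combination -hcomm

omit hξ in
/-- Invariance of `α` says that `2σ` is an eigenvalue of `s + a`, with eigenvector `£_ξ w`. -/
lemma sum_mul_raise_lie1 {σ : ℝ} (hx : x ∈ O)
    (hα : ∀ i, lie1 ξ (tensorAlpha σ g w) x i = 0) (i : Fin n) :
    ∑ j, (tensorS g w x i j + tensorA g w x i j) * raise g (lie1 ξ w) x j =
      2 * σ * lie1 ξ w x i := by
  have hO := hg.isOpen
  have d := fun {f : E n → ℝ} (hf : ContDiffOn ℝ ∞ f O) => differentiableAt_of_contDiffOn hO hf hx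
  have hQ := fun i j => (hg.contDiffOn_tensorS hw i j).add (hg.contDiffOn_tensorA hw i j)
  have hQr := fun i j => (hQ i j).mul (hg.contDiffOn_raise hw j)
  have h := hα i
  rw [lie1_eq] at h
  have h1 : along ξ (fun y => tensorAlpha σ g w y i) x = σ * along ξ (fun y => w y i) x
      - (1 / 2 : ℝ) * ∑ j,
        (along ξ (fun y => tensorS g w y i j + tensorA g w y i j) x * raise g w x j
        + (tensorS g w x i j + tensorA g w x i j) * along ξ (fun y => raise g w y j) x) := by
    simp only [tensorAlpha]
    rw [along_sub (d (contDiffOn_const.mul (hw i)))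
        (d (contDiffOn_const.mul (ContDiffOn.sum fun j _ => hQr i j))),
      along_const_mul (d (hw i)), along_const_mul (d (ContDiffOn.sum fun j _ => hQr i j)),
      along_sum fun j => d (hQr i j)]
    congr 2
    exact sum_congr rfl fun j _ => along_mul (d (hQ i j)) (d (hg.contDiffOn_raise hw j))
  have h2 : ∑ l, tensorAlpha σ g w x l * pd i (fun y => ξ y l) x =
      σ * ∑ l, w x l * pd i (fun y => ξ y l) x - (1 / 2 : ℝ) * ∑ j,
        (∑ l, (tensorS g w x l j + tensorA g w x l j) * pd i (fun y => ξ y l) x)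
          * raise g w x j := by
    simp only [tensorAlpha, sub_mul, sum_sub_distrib, mul_sum, sum_mul]
    congr 1
    · exact sum_congr rfl fun l _ => by ring
    · rw [sum_comm]
      exact sum_congr rfl fun j _ => sum_congr rfl fun l _ => by ring
  have h3 : ∑ j, (∑ l, (tensorS g w x i l + tensorA g w x i l) * pd j (fun y => ξ y l) x)
        * raise g w x j = ∑ j, (tensorS g w x i j + tensorA g w x i j)
          * ∑ l, raise g w x l * pd l (fun y => ξ y j) x := by
    simp only [sum_mul, mul_sum]
    rw [sum_comm]
    exact sum_congr rfl fun j _ => sum_congr rfl fun l _ => by ring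
  rw [h1, h2] at h
  simp only [hg.along_tensorS_add_tensorA hw ha hs hx, hg.along_raise hK hw hx] at h
  simp only [sub_mul, neg_mul, sum_add_distrib, sum_sub_distrib, sum_neg_distrib, h3, mul_add] at h
  rw [lie1_eq]
  linear_combination (-2) * h

end IsMetricOn

end Coordinates

/-! ### Algebra in an adapted orthonormal frame -/

/-- The componentwise form of the curvature statement. Here `R`, `a` and `Q = s + a` are the
components, in an orthonormal frame, of the Riemann tensor, of `a` and of `s + a`, and the indices
with `P` are those of the frame vectors that span `I¹`. -/
lemma frame_algebra {ι : Type*} [DecidableEq ι] {P : ι → Prop} {σ : ℝ}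
    {R : ι → ι → ι → ι → ℝ} {Q a : ι → ι → ℝ}
    (R_left : ∀ i j k l, R i j k l = -R j i k l)
    (R_pair : ∀ i j k l, R i j k l = R k l i j)
    (hQa : ∀ i j, Q i j - Q j i = 2 * a i j)
    (hQ : ∀ i I, P I → Q i I = if i = I then 2 * σ else 0)
    (hR : ∀ I b c d, P I → R I b c d = (if I = b then 1 else 0) * a c d
      + (Q b d * (if I = c then 1 else 0) - Q b c * (if I = d then 1 else 0)) / 2) :
    (∀ i j k l, R i j k l ≠ 0 → (P i ∧ P j ∧ P k ∧ P l) ∨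
      ((P i ∧ ¬ P j ∨ ¬ P i ∧ P j) ∧ (P k ∧ ¬ P l ∨ ¬ P k ∧ P l)) ∨
      (¬ P i ∧ ¬ P j ∧ ¬ P k ∧ ¬ P l)) ∧
    ∀ i j k l, P i → P j → P k → P l → R i j k l =
      σ * ((if i = k then 1 else 0) * (if j = l then 1 else 0)
        - (if i = l then 1 else 0) * (if j = k then 1 else 0)) := by
  -- contracting `hR` twice with the frame vector `e_I` makes `e_I` a null vector of `a`
  have ha1 : ∀ I c, P I → a c I = 0 := by
    intro I c hI
    have h1 := hR I I c I hI
    have h2 := R_left I I c I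
    have h3 := hQ c I hI
    have h4 := hQ I I hI
    have h5 := hQa I c
    have h6 := hQa c I
    by_cases hc : c = I
    · subst hc; linarith
    · rw [if_neg hc] at h3
      rw [if_neg (Ne.symm hc)] at h1
      simp only [if_true] at h1 h4
      linarith
  have hQ' : ∀ I i, P I → Q I i = if I = i then 2 * σ else 0 := by
    intro I i hI
    have h1 := hQa i I
    rw [ha1 I i hI, hQ i I hI] at h1
    simp only [eq_comm (a := I)]
    linarith
  -- contracting once, the terms with `Q` now cancel
  have ha2 : ∀ I, P I → ∀ c d, a c d = 0 := by
    intro I hI c d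
    have h1 := hR I I c d hI
    have h2 := R_left I I c d
    rw [hQ' I d hI, hQ' I c hI] at h1
    simp only [if_true] at h1
    split_ifs at h1 <;> linarith
  have key : ∀ I b c d, P I → R I b c d =
      (Q b d * (if I = c then 1 else 0) - Q b c * (if I = d then 1 else 0)) / 2 := by
    intro I b c d hI
    rw [hR I b c d hI, ha2 I hI]; ring
  have key2 : ∀ i j k l, P i → P j → R i j k l =
      σ * ((if i = k then 1 else 0) * (if j = l then 1 else 0)
        - (if i = l then 1 else 0) * (if j = k then 1 else 0)) := by
    intro i j k l hi hj
    rw [key i j k l hi, hQ' j l hj, hQ' j k hj]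
    split_ifs <;> ring
  have ne : ∀ {i j}, P i → ¬ P j → i ≠ j := fun hi hj h => hj (h ▸ hi)
  have van2 : ∀ i j k l, P i → P j → ¬ (P k ∧ P l) → R i j k l = 0 := by
    intro i j k l hi hj h
    rw [key2 i j k l hi hj]
    by_cases hk : P k
    · have hl : ¬ P l := fun hl => h ⟨hk, hl⟩
      rw [if_neg (ne hi hl), if_neg (ne hj hl)]; ring
    · rw [if_neg (ne hi hk), if_neg (ne hj hk)]; ring
  have van1 : ∀ i j k l, P i → ¬ P j → ¬ P k → ¬ P l → R i j k l = 0 := by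
    intro i j k l hi hj hk hl
    rw [key i j k l hi, if_neg (ne hi hk), if_neg (ne hi hl)]; ring
  -- the pair symmetry and the antisymmetry of `R` reduce every mixed component to these two
  refine ⟨fun i j k l h => ?_, fun i j k l hi hj _ _ => key2 i j k l hi hj⟩
  have v1 := van2 i j k l
  have v2 := fun hk hl hij => (R_pair i j k l).trans (van2 k l i j hk hl hij)
  have v3 := van1 i j k l
  have v4 := fun hj hi hk hl => (R_left i j k l).trans
    (neg_eq_zero.2 (van1 j i k l hj hi hk hl))
  have v5 := fun hk hl hi hj => (R_pair i j k l).trans (van1 k l i j hk hl hi hj)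
  have v6 := fun hl hk hi hj => ((R_pair i j k l).trans (R_left k l i j)).trans
    (neg_eq_zero.2 (van1 l k i j hl hk hi hj))
  clear van1 van2 key2 key ha1 ha2 hQ hQ' hQa hR R_left R_pair
  by_cases hi : P i <;> by_cases hj : P j <;> by_cases hk : P k <;> by_cases hl : P l <;>
    simp_all

/-! ### Smoothness of components in a chart -/

section Charts

variable {n : ℕ} {M : Type*} [TopologicalSpace M] [ChartedSpace (E n) M]
  [IsManifold 𝓘(ℝ, E n) ∞ M] {φ : OpenPartialHomeomorph M (E n)}

lemma contMDiffOn_coordVec (hφ : φ ∈ IsManifold.maximalAtlas 𝓘(ℝ, E n) ∞ M) (i : Fin n) :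
    ContMDiffOn 𝓘(ℝ, E n) 𝓘(ℝ, E n).tangent ∞
      (fun x => (⟨φ.symm x, coordVec φ x i⟩ : TangentBundle 𝓘(ℝ, E n) M)) φ.target := by
  have h1 := (contMDiffOn_symm_of_mem_maximalAtlas hφ).contMDiffOn_tangentMapWithin
    (m := ∞) (by simp) φ.open_target.uniqueMDiffOn
  have h2 : ContMDiffOn 𝓘(ℝ, E n) 𝓘(ℝ, E n).tangent ∞
      (fun x => (⟨x, EuclideanSpace.single i 1⟩ : TangentBundle 𝓘(ℝ, E n) (E n))) φ.target :=
    contMDiffOn_vectorSpace_iff_contDiffOn.2 contDiffOn_const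
  refine (h1.comp h2 fun x hx => hx).congr fun x hx => ?_
  simp only [Function.comp, tangentMapWithin, coordVec]
  rw [mfderivWithin_of_isOpen φ.open_target hx]

lemma contDiffOn_vecComp (hφ : φ ∈ IsManifold.maximalAtlas 𝓘(ℝ, E n) ∞ M) {U : Set M}
    {ξ : ∀ p : M, TangentSpace 𝓘(ℝ, E n) p}
    (hξ : ContMDiffOn 𝓘(ℝ, E n) 𝓘(ℝ, E n).tangent ∞
      (fun p => (⟨p, ξ p⟩ : TangentBundle 𝓘(ℝ, E n) M)) U) (i : Fin n) :
    ContDiffOn ℝ ∞ (fun x => vecComp ξ φ x i) (φ.target ∩ φ.symm ⁻¹' U) := by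
  have h1 := (contMDiffOn_of_mem_maximalAtlas hφ).contMDiffOn_tangentMapWithin
    (m := ∞) (by simp) φ.open_source.uniqueMDiffOn
  have h2 := hξ.comp ((contMDiffOn_symm_of_mem_maximalAtlas hφ).mono
    (Set.inter_subset_left (t := φ.symm ⁻¹' U))) fun x hx => hx.2
  have h3 := h1.comp h2 fun x hx => φ.map_target hx.1
  have h4 : ContDiffOn ℝ ∞ (fun x => (mfderiv 𝓘(ℝ, E n) 𝓘(ℝ, E n) φ (φ.symm x)
      (ξ (φ.symm x)) : E n)) (φ.target ∩ φ.symm ⁻¹' U) := by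
    refine contMDiffOn_vectorSpace_iff_contDiffOn.1 (h3.congr fun x hx => ?_)
    simp only [Function.comp, tangentMapWithin]
    rw [mfderivWithin_of_isOpen φ.open_source (φ.map_target hx.1), φ.right_inv hx.1]
    rfl
  exact (contDiff_piLp_apply (p := 2) (i := i)).comp_contDiffOn h4

lemma Triple.contDiffOn_hComp (T : Triple n M)
    (hφ : φ ∈ IsManifold.maximalAtlas 𝓘(ℝ, E n) ∞ M) (i j : Fin n) :
    ContDiffOn ℝ ∞ (fun x => T.hComp φ x i j) φ.target := by
  have h1 := T.h.contMDiff.comp_contMDiffOn (contMDiffOn_symm_of_mem_maximalAtlas hφ)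
  have h2 := ContMDiffOn.clm_bundle_apply₂ (F₃ := ℝ) (E₃ := Bundle.Trivial M ℝ) h1
    (contMDiffOn_coordVec hφ i) (contMDiffOn_coordVec hφ j)
  intro x hx
  have h3 := h2 x hx
  simp only [Bundle.contMDiffWithinAt_totalSpace] at h3
  exact h3.2.contDiffWithinAt

lemma Triple.contDiffOn_WComp (T : Triple n M)
    (hφ : φ ∈ IsManifold.maximalAtlas 𝓘(ℝ, E n) ∞ M) (i : Fin n) :
    ContDiffOn ℝ ∞ (fun x => T.WComp φ x i) φ.target := by
  have h1 := T.contMDiff_W.comp_contMDiffOn (contMDiffOn_symm_of_mem_maximalAtlas hφ)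
  have h2 := ContMDiffOn.clm_bundle_apply (F₂ := ℝ) (E₂ := Bundle.Trivial M ℝ) h1
    (contMDiffOn_coordVec hφ i)
  intro x hx
  have h3 := h2 x hx
  simp only [Bundle.contMDiffWithinAt_totalSpace] at h3
  exact h3.2.contDiffWithinAt

end Charts

/-! ### Passage to frame components -/

section Frame

variable {n : ℕ} {O : Set (E n)} {x : E n} {g : E n → Fin n → Fin n → ℝ}
  {e : Fin n → Fin n → ℝ}

lemma IsOrthonormalFrame.det_ne_zero (he : IsOrthonormalFrame g x e) :
    (Matrix.of (g x)).det ≠ 0 := by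
  have h : Matrix.of e * Matrix.of (g x) * (Matrix.of e).transpose = 1 := by
    ext a b
    rw [Matrix.one_apply, ← he a b, Matrix.mul_apply, sum_comm]
    refine sum_congr rfl fun j _ => ?_
    rw [Matrix.mul_apply, sum_mul]
    exact sum_congr rfl fun i _ => by simp only [Matrix.of_apply, Matrix.transpose_apply]; ring
  have h' := congrArg Matrix.det h
  rw [Matrix.det_mul, Matrix.det_mul, Matrix.det_one] at h'
  intro h0
  rw [h0] at h'
  simp at h'

/-- A smooth symmetric tensor field that has an orthonormal frame at `x` is nondegenerate near
`x`. -/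
lemma IsOrthonormalFrame.exists_isMetricOn (he : IsOrthonormalFrame g x e) (hO : IsOpen O)
    (hx : x ∈ O) (smooth : ∀ i j, ContDiffOn ℝ ∞ (fun y => g y i j) O)
    (symm : ∀ y ∈ O, ∀ i j, g y i j = g y j i) : ∃ O' ⊆ O, x ∈ O' ∧ IsMetricOn g O' :=
  ⟨O ∩ (fun y => (Matrix.of (g y)).det) ⁻¹' {0}ᶜ, Set.inter_subset_left,
    ⟨hx, he.det_ne_zero⟩,
    { isOpen := (contDiffOn_det smooth).continuousOn.isOpen_inter_preimage hO
        isOpen_compl_singleton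
      smooth := fun i j => (smooth i j).mono Set.inter_subset_left
      symm := fun y hy => symm y hy.1
      det_ne_zero := fun _ hy => hy.2 }⟩

/-- The component `T(e_a, e_b)` at `x` of a tensor of rank two in the frame `e`. -/
noncomputable def frame2 (T : Fin n → Fin n → ℝ) (e : Fin n → Fin n → ℝ) (a b : Fin n) : ℝ :=
  ∑ i, ∑ j, T i j * e a i * e b j

/-- The covector `g(e_a, ·)`. -/
noncomputable def flat (g : E n → Fin n → Fin n → ℝ) (x : E n) (e : Fin n → Fin n → ℝ)
    (a i : Fin n) : ℝ := ∑ j, g x i j * e a j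

lemma IsOrthonormalFrame.sum_flat_mul (he : IsOrthonormalFrame g x e) (a b : Fin n) :
    ∑ i, flat g x e a i * e b i = if a = b then 1 else 0 := by
  simp only [eq_comm (a := a), ← he b a, flat, sum_mul]
  exact sum_congr rfl fun i _ => sum_congr rfl fun j _ => by ring

namespace IsMetricOn

variable (hg : IsMetricOn g O) (hx : x ∈ O)
include hg hx

lemma frameRiem_antisymm_left (a b c d : Fin n) :
    frameRiem g x e a b c d = -frameRiem g x e b a c d := by
  simp only [frameRiem, ← sum_neg_distrib]
  rw [sum_comm]
  exact sum_congr rfl fun j _ => sum_congr rfl fun i _ => sum_congr rfl fun k _ =>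
    sum_congr rfl fun l _ => by rw [hg.riem_antisymm_left hx i j]; ring

lemma frameRiem_pair_symm (a b c d : Fin n) :
    frameRiem g x e a b c d = frameRiem g x e c d a b := by
  simp only [frameRiem]
  calc _ = ∑ i, ∑ k, ∑ j, ∑ l, riem g x i j k l * e a i * e b j * e c k * e d l :=
        sum_congr rfl fun i _ => sum_comm
    _ = ∑ k, ∑ i, ∑ j, ∑ l, riem g x i j k l * e a i * e b j * e c k * e d l := sum_comm
    _ = ∑ k, ∑ i, ∑ l, ∑ j, riem g x i j k l * e a i * e b j * e c k * e d l :=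
        sum_congr rfl fun k _ => sum_congr rfl fun i _ => sum_comm
    _ = ∑ k, ∑ l, ∑ i, ∑ j, riem g x i j k l * e a i * e b j * e c k * e d l :=
        sum_congr rfl fun k _ => sum_comm
    _ = _ := sum_congr rfl fun k _ => sum_congr rfl fun l _ => sum_congr rfl fun i _ =>
        sum_congr rfl fun j _ => by rw [hg.riem_pair_symm hx i j]; ring

/-- The first slot of the Riemann tensor, contracted with the covector `flat g x e a`. -/
lemma frameRiem_eq (a b c d : Fin n) : frameRiem g x e a b c d =
    ∑ i, ∑ j, ∑ k, (∑ l, flat g x e a l * riemUp g x l i j k) * e b i * e c j * e d k := by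
  have h : ∀ i j k, ∑ l, flat g x e a l * riemUp g x l i j k =
      ∑ l, riem g x l i j k * e a l := by
    intro i j k
    simp only [flat, riem, sum_mul]
    rw [sum_comm]
    exact sum_congr rfl fun l _ => sum_congr rfl fun m _ => by rw [hg.symm x hx m l]; ring
  simp only [h, frameRiem, sum_mul]
  calc _ = ∑ i, ∑ l, ∑ j, ∑ k, riem g x l i j k * e a l * e b i * e c j * e d k := sum_comm
    _ = ∑ i, ∑ j, ∑ l, ∑ k, riem g x l i j k * e a l * e b i * e c j * e d k :=
        sum_congr rfl fun i _ => sum_comm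
    _ = _ := sum_congr rfl fun i _ => sum_congr rfl fun j _ => sum_comm

/-- The frame form of the two equations for covectors in `I¹`. -/
lemma frame_equations (he : IsOrthonormalFrame g x e) {σ : ℝ} {Q A : Fin n → Fin n → ℝ} {I : Fin n}
    (h1 : ∀ i, ∑ j, Q i j * ∑ k, ginv g x j k * flat g x e I k = 2 * σ * flat g x e I i)
    (h2 : ∀ i j k, ∑ l, flat g x e I l * riemUp g x l i j k = flat g x e I i * A j k
      + (Q i k * flat g x e I j - Q i j * flat g x e I k) / 2) :
    (∀ a, frame2 Q e a I = if a = I then 2 * σ else 0) ∧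
    ∀ b c d, frameRiem g x e I b c d = (if I = b then 1 else 0) * frame2 A e c d
      + (frame2 Q e b d * (if I = c then 1 else 0)
        - frame2 Q e b c * (if I = d then 1 else 0)) / 2 := by
  constructor
  · intro a
    have h3 : frame2 Q e a I =
        ∑ i, e a i * ∑ j, Q i j * ∑ k, ginv g x j k * flat g x e I k := by
      have h5 : ∀ j, ∑ k, ginv g x j k * flat g x e I k = e I j :=
        hg.sum_ginv_mul_sum_g hx (e I)
      simp only [h5, frame2, mul_sum]
      exact sum_congr rfl fun i _ => sum_congr rfl fun j _ => by ring
    have h4 : ∑ i, e a i * (2 * σ * flat g x e I i) =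
        2 * σ * ∑ i, flat g x e I i * e a i := by
      rw [mul_sum]
      exact sum_congr rfl fun i _ => by ring
    simp only [h3, h1, h4, he.sum_flat_mul, eq_comm (a := I), mul_ite, mul_one, mul_zero]
  · intro b c d
    rw [hg.frameRiem_eq hx, ← he.sum_flat_mul I b, ← he.sum_flat_mul I c, ← he.sum_flat_mul I d]
    have e1 : (∑ i, flat g x e I i * e b i) * frame2 A e c d =
        ∑ i, ∑ j, ∑ k, flat g x e I i * A j k * e b i * e c j * e d k := by
      rw [sum_mul]
      simp only [frame2, mul_sum]
      exact sum_congr rfl fun i _ => sum_congr rfl fun j _ => sum_congr rfl fun k _ => by ring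
    have e2 : frame2 Q e b d * (∑ i, flat g x e I i * e c i) =
        ∑ i, ∑ j, ∑ k, Q i k * flat g x e I j * e b i * e c j * e d k := by
      simp only [frame2, sum_mul]
      simp only [mul_sum]
      refine sum_congr rfl fun i _ => ?_
      rw [sum_comm]
      exact sum_congr rfl fun j _ => sum_congr rfl fun k _ => by ring
    have e3 : frame2 Q e b c * (∑ i, flat g x e I i * e d i) =
        ∑ i, ∑ j, ∑ k, Q i j * flat g x e I k * e b i * e c j * e d k := by
      simp only [frame2, sum_mul]
      simp only [mul_sum]
      exact sum_congr rfl fun i _ => sum_congr rfl fun j _ => sum_congr rfl fun k _ => by ring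
    rw [e1, e2, e3]
    simp only [h2, ← sum_sub_distrib, sum_div, ← sum_add_distrib]
    exact sum_congr rfl fun i _ => sum_congr rfl fun j _ => sum_congr rfl fun k _ => by ring

end IsMetricOn

lemma frame2_sub_frame2_swap {Q A : Fin n → Fin n → ℝ} (h : ∀ i j, Q i j - Q j i = 2 * A i j)
    (a b : Fin n) : frame2 Q e a b - frame2 Q e b a = 2 * frame2 A e a b := by
  simp only [frame2]
  rw [sum_comm (f := fun i j => Q i j * e b i * e a j), ← sum_sub_distrib, mul_sum]
  refine sum_congr rfl fun i _ => ?_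
  rw [← sum_sub_distrib, mul_sum]
  exact sum_congr rfl fun j _ => by linear_combination e a i * e b j * h i j

end Frame

end Kundt

open Kundt in
theorem mainTheorem10 {n m : ℕ} (hm : m ≤ n)
    {M : Type*} [TopologicalSpace M] [ChartedSpace (Kundt.E n) M]
    [IsManifold 𝓘(ℝ, Kundt.E n) ∞ M]
    (T : Kundt.Triple n M) (σ : ℝ) (U : Set M) (hU : IsOpen U)
    (K : Submodule ℝ (∀ p : M, TangentSpace 𝓘(ℝ, Kundt.E n) p))
    (hT : T.IsCSI σ U K)
    (φ : OpenPartialHomeomorph M (Kundt.E n))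
    (hφ : φ ∈ IsManifold.maximalAtlas 𝓘(ℝ, Kundt.E n) ∞ M)
    (x : Kundt.E n) (hx : x ∈ φ.target) (hxU : φ.symm x ∈ U)
    (e : Fin n → Fin n → ℝ)
    (he : Kundt.IsOrthonormalFrame (T.hComp φ) x e)
    (hadapted : T.IsAdapted K φ x m e) :
    -- a nonzero component is of type `R_{IJKL}`, of type `R_{I ĵ K l̂}` up to the antisymmetries
    -- in the first and in the last pair, or of type `R_{î ĵ k̂ l̂}`
    (∀ i j k l : Fin n, Kundt.frameRiem (T.hComp φ) x e i j k l ≠ 0 →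
      ((i : ℕ) < m ∧ (j : ℕ) < m ∧ (k : ℕ) < m ∧ (l : ℕ) < m) ∨
      ((((i : ℕ) < m ∧ m ≤ (j : ℕ)) ∨ (m ≤ (i : ℕ) ∧ (j : ℕ) < m)) ∧
        (((k : ℕ) < m ∧ m ≤ (l : ℕ)) ∨ (m ≤ (k : ℕ) ∧ (l : ℕ) < m))) ∨
      (m ≤ (i : ℕ) ∧ m ≤ (j : ℕ) ∧ m ≤ (k : ℕ) ∧ m ≤ (l : ℕ))) ∧
    (∀ i j k l : Fin n, (i : ℕ) < m → (j : ℕ) < m → (k : ℕ) < m → (l : ℕ) < m →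
      Kundt.frameRiem (T.hComp φ) x e i j k l =
        σ * ((if i = k then 1 else 0) * (if j = l then 1 else 0)
          - (if i = l then 1 else 0) * (if j = k then 1 else 0))) := by
  obtain ⟨O, hOsub, hxO, hg⟩ := he.exists_isMetricOn (O := φ.target ∩ φ.symm ⁻¹' U)
    (φ.isOpen_inter_preimage_symm hU) ⟨hx, hxU⟩
    (fun i j => (T.contDiffOn_hComp hφ i j).mono Set.inter_subset_left)
    (fun y _ i j => T.h.symm _ _ _)
  have hw : ∀ i, ContDiffOn ℝ ∞ (fun y => T.WComp φ y i) O := fun i =>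
    (T.contDiffOn_WComp hφ i).mono fun y hy => (hOsub hy).1
  set g := T.hComp φ
  set w := T.WComp φ
  -- both equations are linear in the covector, hence pass from the `£_ξ W` to their span `I¹`
  have key : ∀ v ∈ T.I1 K φ x,
      (∀ i, ∑ j, (tensorS g w x i j + tensorA g w x i j) * ∑ k, ginv g x j k * v k
        = 2 * σ * v i) ∧
      ∀ i j k, ∑ l, v l * riemUp g x l i j k = v i * tensorA g w x j k
        + ((tensorS g w x i k + tensorA g w x i k) * v j
          - (tensorS g w x i j + tensorA g w x i j) * v k) / 2 := by
    intro v hv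
    induction hv using Submodule.span_induction with
    | mem v hv =>
      obtain ⟨ξ, hξK, rfl⟩ := hv
      have hsym := hT.isSymmetry ξ hξK
      have hξ := fun i => (contDiffOn_vecComp hφ hsym.smooth i).mono hOsub
      have hK := fun y hy => hsym.killing φ hφ y (hOsub hy).1 (hOsub hy).2
      have ha := fun y hy => hsym.lie_a φ hφ y (hOsub hy).1 (hOsub hy).2
      have hs := fun y hy => hsym.lie_s φ hφ y (hOsub hy).1 (hOsub hy).2
      exact ⟨hg.sum_mul_raise_lie1 hK hw ha hs hxO (hsym.lie_alpha φ hφ x hx hxU),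
        hg.sum_lie1_mul_riemUp hξ hK hw ha hs hxO⟩
    | zero => simp
    | add u v _ _ hu hv =>
      refine ⟨fun i => ?_, fun i j k => ?_⟩
      · simp only [Pi.add_apply, mul_add, Finset.sum_add_distrib, hu.1, hv.1]
      · simp only [Pi.add_apply, add_mul, Finset.sum_add_distrib, hu.2, hv.2]; ring
    | smul c v _ hv =>
      refine ⟨fun i => ?_, fun i j k => ?_⟩
      · simp only [Pi.smul_apply, smul_eq_mul, mul_left_comm _ c, ← Finset.mul_sum, hv.1]
      · simp only [Pi.smul_apply, smul_eq_mul, mul_assoc, ← Finset.mul_sum, hv.2]; ring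
  have hframe : ∀ I : Fin n, (I : ℕ) < m → flat g x e I ∈ T.I1 K φ x := fun I hI =>
    hadapted ▸ Submodule.subset_span ⟨I, hI, rfl⟩
  have heq := fun I hI => hg.frame_equations hxO he (key _ (hframe I hI)).1 (key _ (hframe I hI)).2
  have hmain := frame_algebra (P := fun i : Fin n => (i : ℕ) < m) (σ := σ)
    (hg.frameRiem_antisymm_left (e := e) hxO) (hg.frameRiem_pair_symm hxO)
    (frame2_sub_frame2_swap (Q := fun i j => tensorS g w x i j + tensorA g w x i j)
      (A := tensorA g w x) fun i j => by simp only [tensorS, tensorA]; ring)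
    (fun i I hI => (heq I hI).1 i) (fun I b c d hI => (heq I hI).2 b c d)
  simpa only [not_lt] using hmain
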